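/- All graphs are finite, simple and undirected. The max leaf number of a connected graph $G$ is the maximum, over all spanning trees $T$ of $G$, of the number of leaves (vertices of degree one) of $T$. A branch of $G$ is a maximal (under inclusion of subgraphs) path with at least one edge, or cycle, in $G$, in which every internal vertex has degree two in $G$; for a cycle this means that all of its vertices, with at most one exception, have degree two in $G$. Branches are counted as subgraphs. There is an absolute constant $C>0$ such that every connected graph with max leaf number $\ell$ has at most $C\,\ell^2$ branches. Equivalently, there is an absolute constant $c>0$ such that every connected graph with $b$ branches has a spanning tree with at least $c\sqrt{b}$ leaves. -/

import Mathlib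

namespace SimpleGraph

variable {V : Type*} [Fintype V]

open Classical in
/-- The number of leaves (vertices of degree one) of a finite graph. -/
noncomputable def numLeaves (T : SimpleGraph V) : ℕ :=
  (Finset.univ.filter fun v => T.degree v = 1).card

/-- `T` is a spanning tree of `G`: a tree on the whole vertex set all of whose edges are edges
of `G`. -/
def IsSpanningTreeOf (T G : SimpleGraph V) : Prop :=
  T ≤ G ∧ T.IsTree

/-- The max leaf number of a (connected) graph: the maximum of the number of leaves over all
spanning trees. -/
noncomputable def maxLeafNumber (G : SimpleGraph V) : ℕ :=
  sSup {k | ∃ T : SimpleGraph V, T.IsSpanningTreeOf G ∧ T.numLeaves = k}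

/-- For a connected graph the supremum in the definition of the max leaf number is attained by
some spanning tree, so it is a maximum. -/
theorem Connected.isGreatest_maxLeafNumber {G : SimpleGraph V} (hG : G.Connected) :
    IsGreatest {k | ∃ T : SimpleGraph V, T.IsSpanningTreeOf G ∧ T.numLeaves = k}
      G.maxLeafNumber := by
  have hb : BddAbove {k | ∃ T : SimpleGraph V, T.IsSpanningTreeOf G ∧ T.numLeaves = k} := by
    refine ⟨Fintype.card V, ?_⟩
    rintro k ⟨T, -, rfl⟩
    exact Finset.card_le_univ _
  obtain ⟨T, hT, hT'⟩ := hG.exists_isTree_le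
  exact ⟨Nat.sSup_mem ⟨_, T, ⟨hT, hT'⟩, rfl⟩ hb, fun k hk => le_csSup hb hk⟩

open Classical in
/-- Every internal vertex of the walk `p` (every vertex other than its first and last one) has
degree two in `G`. For a closed walk the common first and last vertex is not internal. -/
def Walk.InternalDegreeTwo {G : SimpleGraph V} {u v : V} (p : G.Walk u v) : Prop :=
  ∀ x ∈ p.support.tail.dropLast, G.degree x = 2

/-- `H` is a path with at least one edge, or a cycle, in `G`, whose internal vertices all have
degree two in `G`. (On a cycle, every vertex but one, freely chosen, is internal.) -/
def IsBranchSegment (G : SimpleGraph V) (H : G.Subgraph) : Prop :=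
  (∃ (u v : V) (p : G.Walk u v),
      p.IsPath ∧ 0 < p.length ∧ p.InternalDegreeTwo ∧ p.toSubgraph = H) ∨
  (∃ (v : V) (p : G.Walk v v),
      p.IsCycle ∧ p.InternalDegreeTwo ∧ p.toSubgraph = H)

/-- A branch of `G`: a maximal path or cycle of `G` whose internal vertices all have degree two
in `G`. Branches are subgraphs, so the direction and the starting point of a traversal do not
matter, and maximality is with respect to inclusion of subgraphs. -/
def IsBranch (G : SimpleGraph V) (H : G.Subgraph) : Prop :=
  Maximal G.IsBranchSegment H

/-- The number of branches of `G`. -/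
noncomputable def numBranches (G : SimpleGraph V) : ℕ :=
  {H : G.Subgraph | G.IsBranch H}.ncard

end SimpleGraph

/-!
Let `ℓ` be the max leaf number of a connected graph `G` on at least two vertices, and let `T` be a
spanning tree of `G` with `ℓ` leaves. The number of branches is at most `8 ℓ² + 1 ≤ 9 ℓ²`, for the
following reasons.

*Degrees are at most `ℓ`* (`Connected.degree_le_maxLeafNumber`). The star at a vertex `v` extends to
a spanning tree, and a tree with a vertex of degree `d` has at least `d` leaves.

*At most `8 ℓ` vertices have degree other than two in `G`* (`Connected.card_degree_ne_two_le`). The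
degree sum of a tree bounds the sum of the degrees that are at least three by three times the number
of leaves. So at most `ℓ + 3 ℓ + 3 ℓ` vertices are leaves of `T`, or have degree at least three in
`T`, or are neighbors in `T` of such a vertex of high degree. Each remaining vertex `v` with
`deg_G v ≠ 2` has degree two in `T`, has no neighbor of larger degree in `T`, and has an edge `v w`
of `G` outside `T`. Exchanging `v w` for the edge of `T` that leads from `v` towards `w` turns a neighbor
of `v` into a leaf. Doing this for all such `v` with the same `w` keeps the graph connected
(`Connected.reroute`), gains a leaf for each `v`, and loses at most the leaf `w`. By maximality of
`T`, no `v` belongs to a `w` that is not a leaf of `T`, and at most one belongs to each leaf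
(`card_rerouteSet_le`), which leaves room for at most `ℓ` further vertices.

*Branches are determined by any of their edges* (`IsBranch.eq_of_mem_edgeSet`). By maximality a
branch contains both edges at each of its vertices of degree two
(`IsBranch.adj_of_degree_eq_two`), and hence contains every branch with which it shares an edge.
A branch without a vertex of degree other than two is all of `G`, by connectedness. All other
branches have an edge at one of the at most `8 ℓ` vertices of degree other than two, and there are
at most `8 ℓ · ℓ` such edges.
-/

namespace SimpleGraph

open Finset Classical

variable {V : Type*} {G H T : SimpleGraph V}

/-! ### Leaves and degrees in spanning trees -/

section Leaves

variable [Fintype V]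

theorem IsSpanningTreeOf.numLeaves_le_maxLeafNumber (hT : T.IsSpanningTreeOf G) :
    T.numLeaves ≤ G.maxLeafNumber :=
  (hT.2.connected.mono hT.1).isGreatest_maxLeafNumber.2 ⟨T, hT, rfl⟩

/-- The max leaf number also bounds the number of leaves of connected spanning subgraphs that are
not trees: passing to a spanning tree keeps all vertices of degree one. -/
theorem Connected.card_le_maxLeafNumber [Nontrivial V] (hH : H.Connected) (hHG : H ≤ G)
    {s : Finset V} (hs : ∀ v ∈ s, H.degree v ≤ 1) : #s ≤ G.maxLeafNumber := by
  obtain ⟨T, hTH, hT⟩ := hH.exists_isTree_le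
  refine le_trans (card_le_card fun v hv => ?_)
    (IsSpanningTreeOf.numLeaves_le_maxLeafNumber ⟨hTH.trans hHG, hT⟩)
  have h₁ : T.degree v ≤ H.degree v := degree_le_of_le hTH
  have h₂ := hT.connected.preconnected.degree_pos_of_nontrivial v
  have h₃ := hs v hv
  simp only [mem_filter, mem_univ, true_and]
  omega

/-- Counting edges twice in a tree gives `∑ (deg v - 2) = -2`; adding one for each leaf turns this
into a sum of nonnegative terms. -/
theorem IsTree.sum_degree_sub_two (hT : T.IsTree) :
    ∑ v, ((T.degree v : ℤ) - 2 + if T.degree v = 1 then 1 else 0) = T.numLeaves - 2 := by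
  have h₁ := T.sum_degrees_eq_twice_card_edges
  have h₂ := hT.card_edgeFinset
  have h₃ : ∑ v, (T.degree v : ℤ) = 2 * #T.edgeFinset := by exact_mod_cast h₁
  have h₄ : (#T.edgeFinset : ℤ) + 1 = Fintype.card V := by exact_mod_cast h₂
  rw [sum_add_distrib, sum_sub_distrib, h₃, numLeaves, card_filter]
  simp only [sum_const, card_univ, nsmul_eq_mul]
  push_cast
  linarith

theorem IsTree.sum_le_numLeaves_sub_two [Nontrivial V] (hT : T.IsTree) (s : Finset V) :
    ∑ v ∈ s, ((T.degree v : ℤ) - 2 + if T.degree v = 1 then 1 else 0) ≤ T.numLeaves - 2 := by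
  rw [← hT.sum_degree_sub_two]
  refine sum_le_univ_sum_of_nonneg fun v => ?_
  have := hT.connected.preconnected.degree_pos_of_nontrivial v
  split_ifs <;> omega

theorem IsTree.degree_le_numLeaves [Nontrivial V] (hT : T.IsTree) (v : V) :
    T.degree v ≤ T.numLeaves := by
  have h := hT.sum_le_numLeaves_sub_two {v}
  rw [sum_singleton] at h
  split_ifs at h <;> omega

theorem IsTree.sum_degree_le_three_mul_numLeaves [Nontrivial V] (hT : T.IsTree) :
    ∑ v with 3 ≤ T.degree v, T.degree v ≤ 3 * T.numLeaves := by
  have h := hT.sum_le_numLeaves_sub_two {v | 3 ≤ T.degree v}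
  have h' : ∑ v with 3 ≤ T.degree v, (T.degree v : ℤ) ≤
      ∑ v with 3 ≤ T.degree v,
        3 * ((T.degree v : ℤ) - 2 + if T.degree v = 1 then 1 else 0) := by
    refine sum_le_sum fun v hv => ?_
    have := (mem_filter.1 hv).2
    split_ifs <;> omega
  rw [← mul_sum] at h'
  have h'' : ∑ v with 3 ≤ T.degree v, (T.degree v : ℤ) ≤ 3 * T.numLeaves := by linarith
  exact_mod_cast h''

/-- Some spanning tree contains all edges at `v`, and it has at least `deg v` leaves. -/
theorem Connected.degree_le_maxLeafNumber [Nontrivial V] (hG : G.Connected) (v : V) :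
    G.degree v ≤ G.maxLeafNumber := by
  obtain ⟨T, hle, hTG, hT⟩ := hG.exists_isTree_le_of_le_of_isAcyclic
    (inf_le_left : G ⊓ starGraph v ≤ G) ((isAcyclic_starGraph v).anti inf_le_right)
  refine le_trans ?_ ((hT.degree_le_numLeaves v).trans
    (IsSpanningTreeOf.numLeaves_le_maxLeafNumber ⟨hTG, hT⟩))
  refine card_le_card fun w hw => ?_
  rw [mem_neighborFinset] at hw ⊢
  exact hle ⟨hw, starGraph_center_adj hw.ne⟩

end Leaves

/-! ### Rerouting a spanning tree towards a vertex -/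

/-- In a connected graph, every vertex other than `w` has a neighbor that is closer to `w`. -/
theorem Connected.exists_adj_dist_lt (hT : T.Connected) (w : V) :
    ∃ x : V → V, ∀ u, u ≠ w → T.Adj u (x u) ∧ T.dist (x u) w < T.dist u w := by
  have h : ∀ u, ∃ y, u ≠ w → T.Adj u y ∧ T.dist y w < T.dist u w := by
    intro u
    obtain ⟨p, hp⟩ := hT.exists_walk_length_eq_dist u w
    cases p with
    | nil => exact ⟨w, fun h => (h rfl).elim⟩
    | cons h q =>
      refine ⟨_, fun _ => ⟨h, ?_⟩⟩
      rw [← hp, Walk.length_cons]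
      exact Nat.lt_succ_of_le (dist_le q)
  choose x hx using h
  exact ⟨x, hx⟩

/-- The graph obtained from `T` by replacing, for each `v ∈ S`, the edge from `v` to `x v` by the
edge from `v` to `w`. It is used for `x v` the next vertex after `v` on the way to `w`. -/
def reroute (T : SimpleGraph V) (w : V) (x : V → V) (S : Finset V) : SimpleGraph V :=
  fromRel fun a b =>
    (T.Adj a b ∧ ¬(a ∈ S ∧ b = x a) ∧ ¬(b ∈ S ∧ a = x b)) ∨ (a ∈ S ∧ b = w)

theorem reroute_adj {w : V} {x : V → V} {S : Finset V} {a b : V} :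
    (T.reroute w x S).Adj a b ↔ a ≠ b ∧
      ((T.Adj a b ∧ ¬(a ∈ S ∧ b = x a) ∧ ¬(b ∈ S ∧ a = x b)) ∨
        (a ∈ S ∧ b = w) ∨ (b ∈ S ∧ a = w)) := by
  rw [reroute, fromRel_adj, T.adj_comm b a]
  tauto

/-- Every vertex still reaches `w`: it can follow `x` until it meets `S`, from where there is an
edge to `w`. -/
theorem Connected.reroute (hT : T.Connected) {w : V} {x : V → V} {S : Finset V}
    (hx : ∀ u, u ≠ w → T.Adj u (x u) ∧ T.dist (x u) w < T.dist u w) (hwS : w ∉ S) :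
    (T.reroute w x S).Connected := by
  have key : ∀ n u, T.dist u w = n → (T.reroute w x S).Reachable u w := by
    intro n
    induction n using Nat.strong_induction_on with
    | _ n ih =>
      intro u hu
      by_cases huw : u = w
      · exact huw ▸ Reachable.refl _
      by_cases huS : u ∈ S
      · exact Adj.reachable (reroute_adj.2 ⟨huw, Or.inr (Or.inl ⟨huS, rfl⟩)⟩)
      obtain ⟨hadj, hlt⟩ := hx u huw
      refine Reachable.trans (Adj.reachable ?_) (ih _ (hu ▸ hlt) (x u) rfl)
      refine reroute_adj.2 ⟨hadj.ne, Or.inl ⟨hadj, fun h => huS h.1, ?_⟩⟩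
      -- The edge from `u` to `x u` is not one of the deleted ones, by distances to `w`.
      rintro ⟨hxS, h⟩
      have := (hx (x u) fun hxw => hwS (hxw ▸ hxS)).2
      rw [← h] at this
      omega
  have := hT.nonempty
  exact ⟨fun a b => (key _ a rfl).trans (key _ b rfl).symm⟩

section Exchange

variable [Fintype V]

theorem eq_or_eq_of_degree_le_two {a b c z : V} (h : T.degree a ≤ 2) (hb : T.Adj a b)
    (hc : T.Adj a c) (hbc : b ≠ c) (hz : T.Adj a z) : z = b ∨ z = c := by
  by_contra! hne
  have hsub : ({z, b, c} : Finset V) ⊆ T.neighborFinset a := by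
    intro y hy
    simp only [mem_insert, mem_singleton] at hy
    rw [mem_neighborFinset]
    rcases hy with rfl | rfl | rfl <;> assumption
  have h3 : #({z, b, c} : Finset V) = 3 := card_eq_three.2 ⟨z, b, c, hne.1, hne.2, hbc, rfl⟩
  have := card_le_card hsub
  rw [h3, card_neighborFinset_eq_degree] at this
  omega

/-- The vertices of degree two in `T`, all of whose neighbors in `T` have degree at most two in `T`,
that are joined to `w` by an edge of `G` outside `T`. -/
noncomputable def rerouteSet (G T : SimpleGraph V) (w : V) : Finset V :=
  {v | T.degree v = 2 ∧ (∀ y, T.Adj v y → T.degree y ≤ 2) ∧ G.Adj v w ∧ ¬T.Adj v w}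

/-- Rerouting all of `rerouteSet G T w` to `w` makes a leaf of the next vertex after each of them,
and destroys no leaf except possibly `w`. If `T` has the most leaves possible, then the number of
new leaves is therefore at most one, and zero unless `w` is a leaf. -/
theorem card_rerouteSet_le [Nontrivial V] (hT : T.IsSpanningTreeOf G)
    (hmax : T.numLeaves = G.maxLeafNumber) (w : V) :
    #(rerouteSet G T w) ≤ if T.degree w = 1 then 1 else 0 := by
  obtain ⟨x, hx⟩ := hT.2.connected.exists_adj_dist_lt w
  set S := rerouteSet G T w
  have hmem : ∀ v ∈ S, T.degree v = 2 ∧ (∀ y, T.Adj v y → T.degree y ≤ 2) ∧ G.Adj v w ∧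
      ¬T.Adj v w := fun v hv => (mem_filter.1 hv).2
  have hw : ∀ v ∈ S, v ≠ w := fun v hv => (hmem v hv).2.2.1.ne
  have hxw : ∀ v ∈ S, x v ≠ w := fun v hv h =>
    (hmem v hv).2.2.2 (h ▸ (hx v (hw v hv)).1)
  have hne : ∀ v ∈ S, v ≠ x (x v) := by
    intro v hv h
    have h₁ := (hx v (hw v hv)).2
    have h₂ := (hx (x v) (hxw v hv)).2
    rw [← h] at h₂
    omega
  -- The only neighbors of `x v` in `T` are `v` and `x (x v)`.
  have hnbr : ∀ v ∈ S, ∀ z, T.Adj (x v) z → z = v ∨ z = x (x v) := fun v hv z hz =>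
    eq_or_eq_of_degree_le_two ((hmem v hv).2.1 _ (hx v (hw v hv)).1) (hx v (hw v hv)).1.symm
      (hx (x v) (hxw v hv)).1 (hne v hv) hz
  have hinj : Set.InjOn x S := by
    intro v hv v' hv' h
    rcases hnbr v hv v' (h ▸ (hx v' (hw v' hv')).1.symm) with h' | h'
    · exact h'.symm
    · exact (hne v' hv' (h ▸ h')).elim
  have hconn : (T.reroute w x S).Connected := hT.2.connected.reroute hx fun h => hw w h rfl
  have hle : T.reroute w x S ≤ G := by
    intro a b hab
    rcases (reroute_adj.1 hab).2 with h | ⟨h, rfl⟩ | ⟨h, rfl⟩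
    · exact hT.1 h.1
    · exact (hmem a h).2.2.1
    · exact (hmem b h).2.2.1.symm
  set L : Finset V := {v | T.degree v = 1} with hL
  have hdisj : Disjoint (L.erase w) (S.image x) := by
    rw [Finset.disjoint_left]
    intro y hy hy'
    obtain ⟨v, hv, rfl⟩ := mem_image.1 hy'
    have h₁ : T.degree (x v) = 1 := (mem_filter.1 (mem_of_mem_erase hy)).2
    have h₂ : 1 < T.degree (x v) := by
      rw [← card_neighborFinset_eq_degree, one_lt_card]
      exact ⟨v, by simpa using (hx v (hw v hv)).1.symm, x (x v),
        by simpa using (hx (x v) (hxw v hv)).1, hne v hv⟩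
    omega
  have hcard := hconn.card_le_maxLeafNumber hle (s := L.erase w ∪ S.image x) (by
    intro y hy
    rcases mem_union.1 hy with hy | hy
    · obtain ⟨hyw, hy⟩ := mem_erase.1 hy
      have hy₁ : T.degree y = 1 := (mem_filter.1 hy).2
      rw [← hy₁]
      refine card_le_card fun z hz => ?_
      rw [mem_neighborFinset] at hz ⊢
      rcases (reroute_adj.1 hz).2 with h | ⟨h, -⟩ | ⟨-, h⟩
      · exact h.1
      · have := (hmem y h).1
        omega
      · exact (hyw h).elim
    · obtain ⟨v, hv, rfl⟩ := mem_image.1 hy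
      rw [← card_neighborFinset_eq_degree]
      -- The edge to `x (x v)` survives, or is replaced by the edge to `w`.
      refine (card_le_card (t := {if x v ∈ S then w else x (x v)}) fun z hz => ?_).trans
        (card_singleton _).le
      rw [mem_neighborFinset] at hz
      rw [mem_singleton]
      rcases (reroute_adj.1 hz).2 with ⟨h, h₁, h₂⟩ | ⟨h, rfl⟩ | ⟨-, h⟩
      · rcases hnbr v hv z h with rfl | rfl
        · exact (h₂ ⟨hv, rfl⟩).elim
        · rw [if_neg fun hmem => h₁ ⟨hmem, rfl⟩]
      · rw [if_pos h]
      · exact (hxw v hv h).elim)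
  rw [card_union_of_disjoint hdisj, card_image_of_injOn hinj, ← hmax,
    show T.numLeaves = #L from rfl] at hcard
  split_ifs with hdeg
  · have := card_erase_add_one (show w ∈ L by simpa [hL] using hdeg)
    omega
  · rw [erase_eq_of_notMem (by simpa [hL] using hdeg)] at hcard
    omega

/-- A vertex whose degree in `G` is not two is a leaf of a leaf-maximal spanning tree `T`, or has
degree at least three in `T`, or has a neighbor in `T` of degree at least three, or lies in some
`rerouteSet G T w`. -/
theorem Connected.card_degree_ne_two_le [Nontrivial V] (hG : G.Connected) :
    #{v | G.degree v ≠ 2} ≤ 8 * G.maxLeafNumber := by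
  obtain ⟨T, hT, hmax⟩ := hG.isGreatest_maxLeafNumber.1
  set L : Finset V := {v | T.degree v = 1} with hL
  set B : Finset V := {v | 3 ≤ T.degree v} with hB
  have hcover : ({v | G.degree v ≠ 2} : Finset V) ⊆
      L ∪ B ∪ B.biUnion (fun v => T.neighborFinset v) ∪ univ.biUnion (rerouteSet G T) := by
    intro v hv
    have hv : G.degree v ≠ 2 := (mem_filter.1 hv).2
    have hpos := hT.2.connected.preconnected.degree_pos_of_nontrivial v
    have hle : T.degree v ≤ G.degree v := degree_le_of_le hT.1
    simp only [mem_union, mem_biUnion, mem_univ, true_and]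
    by_contra! hcon
    obtain ⟨⟨⟨h₁, h₂⟩, h₃⟩, h₄⟩ := hcon
    simp only [hL, hB, mem_filter, mem_univ, true_and, mem_neighborFinset] at h₁ h₂ h₃
    have hlt : #(T.neighborFinset v) < #(G.neighborFinset v) := by
      simp only [card_neighborFinset_eq_degree]
      omega
    obtain ⟨w, hwG, hwT⟩ := exists_mem_notMem_of_card_lt_card hlt
    rw [mem_neighborFinset] at hwG hwT
    refine h₄ w (mem_filter.2 ⟨mem_univ _, by omega, fun y hy => ?_, hwG, hwT⟩)
    by_contra! hy'
    exact h₃ y hy' hy.symm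
  have hB₁ : ∑ v ∈ B, T.degree v ≤ 3 * T.numLeaves := hT.2.sum_degree_le_three_mul_numLeaves
  have hB₂ : #B ≤ 3 * T.numLeaves := by
    refine le_trans ?_ hB₁
    rw [card_eq_sum_ones]
    exact sum_le_sum fun v hv => (by decide : 1 ≤ 3).trans (mem_filter.1 hv).2
  have hN : #(B.biUnion fun v => T.neighborFinset v) ≤ 3 * T.numLeaves := by
    refine card_biUnion_le.trans (le_trans (le_of_eq ?_) hB₁)
    simp only [card_neighborFinset_eq_degree]
  have hR : #(univ.biUnion (rerouteSet G T)) ≤ T.numLeaves := by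
    refine card_biUnion_le.trans ((sum_le_sum fun w _ => card_rerouteSet_le hT hmax w).trans ?_)
    rw [← card_filter]
    rfl
  have hL' : #L = T.numLeaves := rfl
  have h₁ := card_le_card hcover
  have h₂ := card_union_le (L ∪ B ∪ B.biUnion fun v => T.neighborFinset v)
    (univ.biUnion (rerouteSet G T))
  have h₃ := card_union_le (L ∪ B) (B.biUnion fun v => T.neighborFinset v)
  have h₄ := card_union_le L B
  omega

end Exchange

/-! ### Branches through a vertex of degree two -/

theorem Walk.mem_internal_of_mem_support {u v x : V} {p : G.Walk u v} (hx : x ∈ p.support)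
    (hu : x ≠ u) (hv : x ≠ v) : x ∈ p.support.tail.dropLast := by
  have hx' : x ∈ p.support.tail := by
    rw [← p.cons_tail_support] at hx
    exact (List.mem_cons.1 hx).resolve_left hu
  have hne : p.support.tail ≠ [] := List.ne_nil_of_mem hx'
  rw [← List.dropLast_append_getLast hne, List.mem_append, List.mem_singleton] at hx'
  refine hx'.resolve_right fun h => hv ?_
  rw [h, List.getLast_tail, Walk.getLast_support]

section Branches

variable [Fintype V]

theorem Walk.InternalDegreeTwo.reverse {u v : V} {p : G.Walk u v} (hp : p.InternalDegreeTwo) :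
    p.reverse.InternalDegreeTwo := by
  intro x hx
  apply hp
  rw [Walk.support_reverse, List.tail_reverse, List.dropLast_reverse, List.mem_reverse] at hx
  rwa [List.tail_dropLast] at hx

/-- Prepending an edge makes the old first vertex internal, and no other. -/
theorem Walk.InternalDegreeTwo.cons {u v w : V} {p : G.Walk u v} (hp : p.InternalDegreeTwo)
    (hu : G.degree u = 2) (h : G.Adj w u) : (Walk.cons h p).InternalDegreeTwo := by
  intro x hx
  rw [Walk.support_cons, List.tail_cons] at hx
  by_cases hxu : x = u
  · exact hxu ▸ hu
  apply hp
  rw [← p.cons_tail_support] at hx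
  by_cases hne : p.support.tail = []
  · simp [hne] at hx
  rw [List.dropLast_cons_of_ne_nil hne] at hx
  exact (List.mem_cons.1 hx).resolve_left hxu

theorem Subgraph.adj_of_ncard_neighborSet_eq_two {H : G.Subgraph} {x z : V}
    (hx : G.degree x = 2) (hH : (H.neighborSet x).ncard = 2) (hz : G.Adj x z) : H.Adj x z := by
  have hG : (G.neighborSet x).ncard = 2 := by
    rw [Set.ncard_eq_toFinset_card', ← hx]
    rfl
  have := Set.eq_of_subset_of_ncard_le (H.neighborSet_subset x) (by rw [hG, hH])
  exact (this.symm ▸ hz : z ∈ H.neighborSet x)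

theorem Walk.IsPath.toSubgraph_adj_of_internal {u v x z : V} {p : G.Walk u v} (hp : p.IsPath)
    (hp' : p.InternalDegreeTwo) (hx : x ∈ p.support) (hu : x ≠ u) (hv : x ≠ v)
    (hz : G.Adj x z) : p.toSubgraph.Adj x z := by
  have hdeg := hp' x (Walk.mem_internal_of_mem_support hx hu hv)
  obtain ⟨i, rfl, hi⟩ := Walk.mem_support_iff_exists_getVert.1 hx
  refine Subgraph.adj_of_ncard_neighborSet_eq_two hdeg
    (hp.ncard_neighborSet_toSubgraph_internal_eq_two ?_ ?_) hz
  · rintro rfl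
    exact hu p.getVert_zero
  · refine lt_of_le_of_ne hi ?_
    rintro rfl
    exact hv p.getVert_length

/-- If a branch is a path that starts at a vertex `u` of degree two, then it contains both edges at
`u`: otherwise prepending the missing edge gives a longer path, or a cycle. -/
theorem IsBranch.adj_start {u v z : V} {p : G.Walk u v} (hB : G.IsBranch p.toSubgraph)
    (hp : p.IsPath) (hlen : 0 < p.length) (hp' : p.InternalDegreeTwo) (hu : G.degree u = 2)
    (hz : G.Adj u z) : p.toSubgraph.Adj u z := by
  by_contra hcon
  have hmax : ¬G.IsBranchSegment (Walk.cons hz.symm p).toSubgraph := by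
    intro hseg
    have hle : p.toSubgraph ≤ (Walk.cons hz.symm p).toSubgraph := le_sup_right
    refine hcon ((hB.2 hseg hle).2 ?_)
    rw [Walk.adj_toSubgraph_iff_mem_edges, Walk.edges_cons, Sym2.eq_swap]
    exact List.mem_cons_self
  have hcons := hp'.cons hu hz.symm
  by_cases hzp : z ∈ p.support
  · by_cases hzv : z = v
    · subst hzv
      refine hmax (Or.inr ⟨z, _, (Walk.cons_isCycle_iff _ _).2 ⟨hp, fun h => hcon ?_⟩, hcons, rfl⟩)
      rwa [Walk.adj_toSubgraph_iff_mem_edges, Sym2.eq_swap]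
    · exact hcon (hp.toSubgraph_adj_of_internal hp' hzp hz.ne' hzv hz.symm).symm
  · exact hmax (Or.inl ⟨z, v, _, hp.cons hzp, by simp, hcons, rfl⟩)

/-- A branch through a vertex of degree two contains both edges at that vertex. -/
theorem IsBranch.adj_of_degree_eq_two {H : G.Subgraph} (hB : G.IsBranch H) {x z : V}
    (hx : G.degree x = 2) (hxH : x ∈ H.verts) (hz : G.Adj x z) : H.Adj x z := by
  rcases hB.prop with ⟨u, v, p, hp, hlen, hp', rfl⟩ | ⟨v, p, hp, -, rfl⟩
  · rw [Walk.mem_verts_toSubgraph] at hxH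
    by_cases hxu : x = u
    · subst hxu
      exact hB.adj_start hp hlen hp' hx hz
    by_cases hxv : x = v
    · subst hxv
      rw [← Walk.toSubgraph_reverse] at hB ⊢
      exact hB.adj_start hp.reverse (by simpa using hlen) hp'.reverse hx hz
    · exact hp.toSubgraph_adj_of_internal hp' hxH hxu hxv hz
  · rw [Walk.mem_verts_toSubgraph] at hxH
    exact Subgraph.adj_of_ncard_neighborSet_eq_two hx (hp.ncard_neighborSet_toSubgraph_eq_two hxH) hz

/-! ### Branches that share an edge are equal -/

/-- A set of edges that contains, with an edge at a vertex of degree two, the other edge at that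
vertex contains all edges of a branch segment or none of them. -/
theorem Walk.InternalDegreeTwo.edges_subset {E : Set (Sym2 V)}
    (hE : ∀ x y z, G.degree x = 2 → s(x, y) ∈ E → G.Adj x z → s(x, z) ∈ E) :
    ∀ {u v : V} {p : G.Walk u v}, p.InternalDegreeTwo → ∀ e ∈ p.edges, e ∈ E →
      ∀ f ∈ p.edges, f ∈ E := by
  intro u v p
  induction p with
  | nil => simp
  | @cons u a v h q ih =>
    cases q with
    | nil => simp
    | @cons a b v h' r =>
      intro hp e he heE f hf
      have ha : G.degree a = 2 := hp a (by simp [List.dropLast_cons_of_ne_nil])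
      have hq : (Walk.cons h' r).InternalDegreeTwo := by
        intro x hx
        refine hp x ?_
        simp only [Walk.support_cons, List.tail_cons] at hx ⊢
        rw [List.dropLast_cons_of_ne_nil (by simp)]
        exact List.mem_cons_of_mem _ hx
      have hab : s(a, b) ∈ (Walk.cons h' r).edges := by simp
      have hiff : s(u, a) ∈ E ↔ s(a, b) ∈ E :=
        ⟨fun hua => hE a u b ha (Sym2.eq_swap ▸ hua) h',
          fun hab => Sym2.eq_swap ▸ hE a b u ha hab h.symm⟩
      have hall : ∀ g ∈ (Walk.cons h' r).edges, g ∈ E := by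
        rw [Walk.edges_cons, List.mem_cons] at he
        rcases he with rfl | he
        · exact ih hq _ hab (hiff.1 heE)
        · exact ih hq e he heE
      rw [Walk.edges_cons, List.mem_cons] at hf
      rcases hf with rfl | hf
      · exact hiff.2 (hall _ hab)
      · exact hall f hf

theorem IsBranchSegment.exists_walk {H : G.Subgraph} (hH : G.IsBranchSegment H) :
    ∃ (u v : V) (p : G.Walk u v), ¬p.Nil ∧ p.InternalDegreeTwo ∧ p.toSubgraph = H := by
  rcases hH with ⟨u, v, p, -, hlen, hp', rfl⟩ | ⟨v, p, hp, hp', rfl⟩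
  · exact ⟨u, v, p, Walk.not_nil_iff_lt_length.2 hlen, hp', rfl⟩
  · exact ⟨v, v, p, hp.not_nil, hp', rfl⟩

theorem IsBranch.le_of_mem_edgeSet {H₁ H₂ : G.Subgraph} (h₁ : G.IsBranch H₁)
    (h₂ : G.IsBranch H₂) {e : Sym2 V} (he₁ : e ∈ H₁.edgeSet) (he₂ : e ∈ H₂.edgeSet) :
    H₁ ≤ H₂ := by
  obtain ⟨u, v, p, hnil, hp, rfl⟩ := h₁.prop.exists_walk
  rw [Walk.toSubgraph_le_iff hnil]
  rw [Walk.mem_edges_toSubgraph] at he₁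
  exact fun f hf => hp.edges_subset (E := H₂.edgeSet)
    (fun x y z hx hy hz => h₂.adj_of_degree_eq_two hx (H₂.edge_vert hy) hz) e he₁ he₂ f hf

theorem IsBranch.eq_of_mem_edgeSet {H₁ H₂ : G.Subgraph} (h₁ : G.IsBranch H₁)
    (h₂ : G.IsBranch H₂) {e : Sym2 V} (he₁ : e ∈ H₁.edgeSet) (he₂ : e ∈ H₂.edgeSet) :
    H₁ = H₂ :=
  (h₁.le_of_mem_edgeSet h₂ he₁ he₂).antisymm (h₂.le_of_mem_edgeSet h₁ he₂ he₁)

theorem IsBranchSegment.exists_adj {H : G.Subgraph} (hH : G.IsBranchSegment H) {x : V}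
    (hx : x ∈ H.verts) : ∃ y, H.Adj x y := by
  obtain ⟨u, v, p, hnil, -, rfl⟩ := hH.exists_walk
  rw [Walk.mem_verts_toSubgraph, Walk.mem_support_iff_exists_mem_edges_of_not_nil hnil] at hx
  obtain ⟨e, he, hxe⟩ := hx
  obtain ⟨y, rfl⟩ := hxe
  exact ⟨y, Walk.adj_toSubgraph_iff_mem_edges.2 he⟩

/-- A branch that avoids the vertices of degree other than two is the whole graph. -/
theorem IsBranch.eq_top {H : G.Subgraph} (hG : G.Connected) (hB : G.IsBranch H)
    (hH : ∀ x ∈ H.verts, G.degree x = 2) : H = ⊤ := by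
  have hadj : ∀ x ∈ H.verts, ∀ z, G.Adj x z → H.Adj x z := fun x hx z hz =>
    hB.adj_of_degree_eq_two (hH x hx) hx hz
  have hwalk : ∀ {u v : V}, G.Walk u v → u ∈ H.verts → v ∈ H.verts := by
    intro u v p
    induction p with
    | nil => exact id
    | cons h q ih => exact fun hu => ih (H.edge_vert (hadj _ hu _ h).symm)
  obtain ⟨u, v, p, -, -, rfl⟩ := hB.prop.exists_walk
  have hverts : ∀ x, x ∈ p.toSubgraph.verts := fun x =>
    hwalk (hG.preconnected u x).some p.start_mem_verts_toSubgraph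
  exact top_le_iff.1 ⟨fun x _ => hverts x, fun x z hz => hadj x (hverts x) z hz⟩

/-! ### The number of branches -/

/-- Every branch, with at most one exception, has an edge at a vertex of degree other than two, and
that edge determines it. -/
theorem Connected.numBranches_le_sum_degree (hG : G.Connected) :
    G.numBranches ≤ ∑ v with G.degree v ≠ 2, G.degree v + 1 := by
  set E : Finset (Sym2 V) :=
    ({v | G.degree v ≠ 2} : Finset V).biUnion (fun v => G.incidenceFinset v)
  have hcard : #E ≤ ∑ v with G.degree v ≠ 2, G.degree v := by
    refine card_biUnion_le.trans (le_of_eq (sum_congr rfl fun v _ => ?_))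
    exact card_incidenceFinset_eq_degree G v
  set A : Set G.Subgraph := {H | G.IsBranch H ∧ ∃ e ∈ E, e ∈ H.edgeSet}
  have hsub : {H | G.IsBranch H} ⊆ A ∪ {⊤} := by
    intro H hH
    by_cases hdeg : ∀ x ∈ H.verts, G.degree x = 2
    · exact Or.inr (IsBranch.eq_top hG hH hdeg)
    · push Not at hdeg
      obtain ⟨x, hx, hdx⟩ := hdeg
      obtain ⟨y, hy⟩ := hH.prop.exists_adj hx
      refine Or.inl ⟨hH, s(x, y), ?_, hy⟩
      refine mem_biUnion.2 ⟨x, by simpa using hdx, ?_⟩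
      rw [mem_incidenceFinset]
      exact ⟨hy.adj_sub, Sym2.mem_mk_left x y⟩
  have hchoose : ∀ H : G.Subgraph, ∃ e, H ∈ A → e ∈ E ∧ e ∈ H.edgeSet := by
    intro H
    by_cases hH : H ∈ A
    · exact ⟨hH.2.choose, fun _ => hH.2.choose_spec⟩
    · obtain ⟨v⟩ := hG.nonempty
      exact ⟨s(v, v), fun h => (hH h).elim⟩
  choose f hf using hchoose
  have hAE : A.ncard ≤ #E := by
    rw [← Set.ncard_coe_finset]
    refine Set.ncard_le_ncard_of_injOn f (fun H hH => (hf H hH).1) ?_ E.finite_toSet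
    intro H hH H' hH' h
    exact hH.1.eq_of_mem_edgeSet hH'.1 (hf H hH).2 (h ▸ (hf H' hH').2)
  calc G.numBranches ≤ (A ∪ {⊤}).ncard := Set.ncard_le_ncard hsub (Set.toFinite _)
    _ ≤ A.ncard + 1 := (Set.ncard_union_le _ _).trans (by rw [Set.ncard_singleton])
    _ ≤ _ := by omega

theorem IsBranchSegment.nontrivial {H : G.Subgraph} (hH : G.IsBranchSegment H) :
    Nontrivial V := by
  obtain ⟨u, v, p, hnil, -⟩ := hH.exists_walk
  exact ⟨u, p.snd, (p.adj_snd hnil).ne⟩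

theorem Connected.numBranches_le (hG : G.Connected) :
    G.numBranches ≤ 9 * G.maxLeafNumber ^ 2 := by
  rcases Nat.eq_zero_or_pos G.numBranches with h | h
  · omega
  obtain ⟨H, hH⟩ := Set.nonempty_of_ncard_ne_zero h.ne'
  have := hH.prop.nontrivial
  have hdeg : ∑ v with G.degree v ≠ 2, G.degree v ≤ 8 * G.maxLeafNumber * G.maxLeafNumber :=
    (sum_le_card_nsmul _ _ _ fun v _ => hG.degree_le_maxLeafNumber v).trans
      (Nat.mul_le_mul_right _ hG.card_degree_ne_two_le)
  have hpos : 0 < G.maxLeafNumber :=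
    (hG.preconnected.degree_pos_of_nontrivial hG.nonempty.some).trans_le
      (hG.degree_le_maxLeafNumber _)
  have := hG.numBranches_le_sum_degree
  nlinarith

end Branches

end SimpleGraph

theorem mainTheorem3 :
    (∃ C : ℝ, 0 < C ∧
      ∀ (V : Type*) [Fintype V] (G : SimpleGraph V), G.Connected →
        (G.numBranches : ℝ) ≤ C * (G.maxLeafNumber : ℝ) ^ 2) ∧
    (∃ c : ℝ, 0 < c ∧
      ∀ (V : Type*) [Fintype V] (G : SimpleGraph V), G.Connected →
        ∃ T : SimpleGraph V, T.IsSpanningTreeOf G ∧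
          c * Real.sqrt (G.numBranches : ℝ) ≤ (T.numLeaves : ℝ)) := by
  refine ⟨⟨9, by norm_num, fun V _ G hG => ?_⟩, ⟨1 / 3, by norm_num, fun V _ G hG => ?_⟩⟩
  · exact_mod_cast hG.numBranches_le
  · obtain ⟨T, hT, hmax⟩ := hG.isGreatest_maxLeafNumber.1
    refine ⟨T, hT, ?_⟩
    have h : (G.numBranches : ℝ) ≤ (3 * T.numLeaves) ^ 2 := by
      rw [hmax]
      have : (G.numBranches : ℝ) ≤ 9 * (G.maxLeafNumber : ℝ) ^ 2 := by
        exact_mod_cast hG.numBranches_le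
      linarith
    have := Real.sqrt_le_left (by positivity) |>.2 h
    linarith
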